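/- Let $K$ be a field and $n\ge 0$. Consider the associative unital $K$-algebra $\mathcal A$ with generators $x^1,\dots,x^n$ and quadratic relations $$x^jx^k=\sum_{a,b}c^{jk}_{ab}\,x^ax^b\qquad(j<k).$$ Call it (with these relations) *orderable* if $c^{jk}_{ab}\neq0$ ($j<k$) only when $a\ge b$ and either $a>j$ or $a=j$, $b>k$, and if the ordered monomials $x^{i_1}x^{i_2}\cdots x^{i_r}$, $i_1\ge i_2\ge\dots\ge i_r$, $r\ge0$, form a basis of $\mathcal A$ over $K$; *rime* if $c^{jk}_{ab}\neq 0$ ($j<k$) only when $\{a,b\}\subset\{j,k\}$. The relations of an orderable rime algebra are thus $x^jx^k=f_{jk}x^kx^j+g_{jk}x^kx^k$, $j<k$, and it is *strict* if all $f_{jk},g_{jk}$ with $j<k$ are nonzero. Proposition. Let $\mathcal A$ be an orderable quadratic strict rime algebra; if $n=2$, assume moreover that $f_{12}\neq1$. Then, up to a rescaling of variables $x^i\mapsto d_ix^i$ with all $d_i\in K\setminus\{0\}$, $\mathcal A$ has relations either of the form (i) $x^jx^k=-x^kx^j+g_{jk}x^kx^k$, $j<k$, with all $g_{jk}\neq0$,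 or of the form (ii) $x^jx^k=f\,x^kx^j+(1-f)\,x^kx^k$, $j<k$, with $f\in K$, $f\neq0,1$. Conversely, for arbitrary $g_{jk}\in K$ the relations (i), and for arbitrary $f\in K$ the relations (ii), define an orderable rime algebra; in particular, in both cases the ordered monomials form a basis. The algebra (i) is strict if all $g_{jk}\neq0$, and the algebra (ii) is strict if $f\neq0,1$. -/

import Mathlib

namespace RimeAlgebra

variable {K : Type*} [Field K] {n : ℕ}

/-- Structure constants of a quadratic rewriting system in the variables `x i`, `i : Fin n`:
`c j k a b` is the coefficient of `x a * x b` in the expression for `x j * x k`.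
Only the values with `j < k` are used. -/
abbrev Coeffs (K : Type*) (n : ℕ) : Type _ := Fin n → Fin n → Fin n → Fin n → K

/-- The defining relations `x j * x k = ∑ a b, c j k a b • (x a * x b)` for `j < k`. -/
inductive Rel (c : Coeffs K n) : FreeAlgebra K (Fin n) → FreeAlgebra K (Fin n) → Prop
  | mk (j k : Fin n) (h : j < k) :
      Rel c (FreeAlgebra.ι K j * FreeAlgebra.ι K k)
        (∑ a, ∑ b, c j k a b • (FreeAlgebra.ι K a * FreeAlgebra.ι K b))

/-- The associative unital `K`-algebra generated by `x i`, `i : Fin n`, with the relations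
`x j * x k = ∑ a b, c j k a b • (x a * x b)` for `j < k`. -/
abbrev Alg (c : Coeffs K n) : Type _ := RingQuot (Rel c)

/-- The generators `x i`. -/
noncomputable def x (c : Coeffs K n) (i : Fin n) : Alg c :=
  RingQuot.mkAlgHom K (Rel c) (FreeAlgebra.ι K i)

/-- The ordered monomials `x i₁ * x i₂ * ⋯ * x iᵣ` with `i₁ ≥ i₂ ≥ ⋯ ≥ iᵣ`, `r ≥ 0`. -/
noncomputable def orderedMonomial (c : Coeffs K n)
    (l : {l : List (Fin n) // l.Pairwise (· ≥ ·)}) : Alg c :=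
  (l.1.map (x c)).prod

/-- The ordered monomials form a basis of the algebra, as a vector space over `K`. -/
def HasOrderedBasis (c : Coeffs K n) : Prop :=
  LinearIndependent K (orderedMonomial c) ∧
    Submodule.span K (Set.range (orderedMonomial c)) = ⊤

/-- The relations express `x j * x k`, `j < k`, through products `x a * x b` with `a ≥ b` such
that `(a, b)` is lexicographically greater than `(j, k)`. -/
def IsLexicographic (c : Coeffs K n) : Prop :=
  ∀ j k a b : Fin n, j < k → c j k a b ≠ 0 → a ≥ b ∧ (a > j ∨ (a = j ∧ b > k))

/-- The relations give a lexicographical order: they rewrite each disordered product `x j * x k`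
through lexicographically greater ordered ones, and this is consistent, that is, the ordered
monomials form a basis. -/
def IsOrderable (c : Coeffs K n) : Prop :=
  IsLexicographic c ∧ HasOrderedBasis c

/-- The rime condition: `x a * x b` occurs in the expression for `x j * x k` only if
`{a, b} ⊆ {j, k}`. -/
def IsRime (c : Coeffs K n) : Prop :=
  ∀ j k a b : Fin n, j < k → c j k a b ≠ 0 → ({a, b} : Set (Fin n)) ⊆ {j, k}

/-- Strictness: in `x j * x k = f j k • (x k * x j) + g j k • (x k * x k)`, `j < k`, all the
coefficients `f j k = c j k k j` and `g j k = c j k k k` are nonzero. -/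
def IsStrict (c : Coeffs K n) : Prop :=
  ∀ j k : Fin n, j < k → c j k k j ≠ 0 ∧ c j k k k ≠ 0

/-- The relations `x j * x k = f j k • (x k * x j) + g j k • (x k * x k)` for `j < k`. -/
def rimeCoeffs (f g : Fin n → Fin n → K) : Coeffs K n := fun j k a b =>
  if a = k ∧ b = j then f j k else if a = k ∧ b = k then g j k else 0

/-- Type (i): `x j * x k = - x k * x j + g j k • (x k * x k)` for `j < k`. -/
def typeI (g : Fin n → Fin n → K) : Coeffs K n :=
  rimeCoeffs (fun _ _ => -1) g

/-- Type (ii): `x j * x k = f • (x k * x j) + (1 - f) • (x k * x k)` for `j < k`. -/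
def typeII (n : ℕ) (f : K) : Coeffs K n :=
  rimeCoeffs (fun _ _ => f) (fun _ _ => 1 - f)

/-- The rescaling `x i ↦ d i • x i` of the variables (all `d i` invertible) turns the algebra
with the relations `c` into the algebra with the relations `c'`. -/
def RescalesTo (d : Fin n → Kˣ) (c c' : Coeffs K n) : Prop :=
  ∃ e : Alg c ≃ₐ[K] Alg c', ∀ i : Fin n, e (x c i) = (d i : K) • x c' i

end RimeAlgebra

/-! ### Universal property of the algebras -/

namespace RimeAlgebra

variable {K : Type*} [Field K] {n : ℕ}

/-! Necessity: for `i < j < k` the word `x i * x j * x k` can be ordered in two ways. Their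
difference is a combination of four ordered cubic monomials (`overlap_eq_zero`), so independence
kills its coefficients. Under strictness this forces one common value `f` of the swap coefficients
and `(1 + f) * (g i j * g j k - (1 - f) * g i k) = 0`. Either `f = -1`, which is type (i), or the
second factor vanishes; then `f ≠ 1`, and dividing out the values `g j m`, `m` the last index, gives
type (ii). Sufficiency: both types satisfy this equation (`IsConsistent`), which is what makes the
algebra an Ore extension, by `x 0`, of the algebra on the remaining generators: `x 0 * p = σ p * x 0
+ δ p`, with `σ (x k) = f • x k` and `δ (x k) = g 0 k • x k ^ 2`. Hence `normalForm_bijective`, and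
the ordered basis follows by induction on `n`. The extension is free on the powers of `x 0` even
when `f = 0` and `σ` is not injective. -/

theorem Alg.induction {c : Coeffs K n} {motive : Alg c → Prop}
    (algebraMap : ∀ r : K, motive (algebraMap K (Alg c) r)) (gen : ∀ i, motive (x c i))
    (mul : ∀ a b, motive a → motive b → motive (a * b))
    (add : ∀ a b, motive a → motive b → motive (a + b)) (a : Alg c) : motive a := by
  obtain ⟨p, rfl⟩ := RingQuot.mkAlgHom_surjective K (Rel c) a
  induction p using FreeAlgebra.induction with
  | grade0 r => simpa using algebraMap r
  | grade1 i => exact gen i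
  | mul p q hp hq => simpa using mul _ _ hp hq
  | add p q hp hq => simpa using add _ _ hp hq

theorem Alg.algHom_ext {c : Coeffs K n} {B : Type*} [Semiring B] [Algebra K B]
    {φ ψ : Alg c →ₐ[K] B} (h : ∀ i, φ (x c i) = ψ (x c i)) : φ = ψ := by
  ext i
  exact h i

/-- In a lexicographic rime system only two terms survive on the right of each relation. -/
theorem sum_smul_eq {c : Coeffs K n} (hl : IsLexicographic c) (hr : IsRime c)
    {B : Type*} [AddCommMonoid B] [Module K B] (y : Fin n → Fin n → B) {j k : Fin n}
    (h : j < k) :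
    ∑ a, ∑ b, c j k a b • y a b = c j k k j • y k j + c j k k k • y k k := by
  have hz : ∀ a b, ¬(a = k ∧ (b = j ∨ b = k)) → c j k a b = 0 := by
    intro a b hab
    by_contra hne
    have h1 := hl j k a b h hne
    have h2 := hr j k a b h hne
    have ha : a = j ∨ a = k := by simpa using h2 (Set.mem_insert a {b})
    have hb : b = j ∨ b = k := by simpa using h2 (Set.mem_insert_of_mem a rfl)
    grind
  rw [Finset.sum_eq_single k, ← Finset.sum_subset (Finset.subset_univ {j, k}),
    Finset.sum_pair h.ne]
  · intro b _ hb
    rw [hz k b (by simpa using hb), zero_smul]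
  · intro a _ ha
    exact Finset.sum_eq_zero fun b _ => by rw [hz a b (by tauto), zero_smul]
  · simp

theorem x_mul_x {c : Coeffs K n} (hl : IsLexicographic c) (hr : IsRime c) {j k : Fin n}
    (h : j < k) :
    x c j * x c k = c j k k j • (x c k * x c j) + c j k k k • (x c k * x c k) := by
  have := RingQuot.mkAlgHom_rel K (Rel.mk (c := c) j k h)
  rw [sum_smul_eq hl hr _ h] at this
  simpa [x] using this

/-- The algebra homomorphism determined by images of the generators satisfying the relations. -/
noncomputable def liftAlg {c : Coeffs K n} (hl : IsLexicographic c) (hr : IsRime c)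
    {B : Type*} [Semiring B] [Algebra K B] (y : Fin n → B)
    (hy : ∀ j k, j < k → y j * y k = c j k k j • (y k * y j) + c j k k k • (y k * y k)) :
    Alg c →ₐ[K] B :=
  RingQuot.liftAlgHom K ⟨FreeAlgebra.lift K y, by
    rintro _ _ ⟨j, k, h⟩
    simpa [sum_smul_eq hl hr (fun a b => y a * y b) h] using hy j k h⟩

theorem liftAlg_x {c : Coeffs K n} (hl : IsLexicographic c) (hr : IsRime c)
    {B : Type*} [Semiring B] [Algebra K B] (y : Fin n → B)
    (hy : ∀ j k, j < k → y j * y k = c j k k j • (y k * y j) + c j k k k • (y k * y k))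
    (i : Fin n) : liftAlg hl hr y hy (x c i) = y i := by
  simp [liftAlg, x]

section RimeCoeffs

variable (f g : Fin n → Fin n → K)

theorem isLexicographic_rimeCoeffs : IsLexicographic (rimeCoeffs f g) := by
  intro j k a b h hne
  unfold rimeCoeffs at hne
  grind

theorem isRime_rimeCoeffs : IsRime (rimeCoeffs f g) := by
  intro j k a b h hne
  unfold rimeCoeffs at hne
  have : (a = k ∧ b = j) ∨ (a = k ∧ b = k) := by grind
  rcases this with ⟨rfl, rfl⟩ | ⟨rfl, rfl⟩
  · rw [Set.pair_comm]
  · simp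

theorem rimeCoeffs_swap (j k : Fin n) : rimeCoeffs f g j k k j = f j k := by
  simp [rimeCoeffs]

theorem rimeCoeffs_diag {j k : Fin n} (h : j < k) : rimeCoeffs f g j k k k = g j k := by
  simp [rimeCoeffs, h.ne']

theorem isStrict_rimeCoeffs (h : ∀ j k, j < k → f j k ≠ 0 ∧ g j k ≠ 0) :
    IsStrict (rimeCoeffs f g) := by
  intro j k hjk
  rw [rimeCoeffs_swap, rimeCoeffs_diag f g hjk]
  exact h j k hjk

theorem x_mul_x_rimeCoeffs {j k : Fin n} (h : j < k) :
    x (rimeCoeffs f g) j * x (rimeCoeffs f g) k =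
      f j k • (x (rimeCoeffs f g) k * x (rimeCoeffs f g) j) +
        g j k • (x (rimeCoeffs f g) k * x (rimeCoeffs f g) k) := by
  have := x_mul_x (isLexicographic_rimeCoeffs f g) (isRime_rimeCoeffs f g) h
  rwa [rimeCoeffs_swap, rimeCoeffs_diag f g h] at this

variable {f g}

/-- The homomorphism from a rime algebra determined by images of the generators. -/
noncomputable def liftRime {B : Type*} [Semiring B] [Algebra K B] (y : Fin n → B)
    (hy : ∀ j k, j < k → y j * y k = f j k • (y k * y j) + g j k • (y k * y k)) :
    Alg (rimeCoeffs f g) →ₐ[K] B :=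
  liftAlg (isLexicographic_rimeCoeffs f g) (isRime_rimeCoeffs f g) y fun j k h => by
    rw [rimeCoeffs_swap, rimeCoeffs_diag f g h]
    exact hy j k h

theorem liftRime_x {B : Type*} [Semiring B] [Algebra K B] (y : Fin n → B)
    (hy : ∀ j k, j < k → y j * y k = f j k • (y k * y j) + g j k • (y k * y k)) (i : Fin n) :
    liftRime y hy (x (rimeCoeffs f g) i) = y i :=
  liftAlg_x _ _ y _ i

end RimeCoeffs

/-! ### Rescaling of the generators -/

/-- Both terms containing `x j` scale alike, so the swap coefficient is invariant and only the
square coefficient changes, by `d k / d j`. The inverse rescaling supplies the inverse map. -/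
theorem rescalesTo_rimeCoeffs {c : Coeffs K n} (hl : IsLexicographic c) (hr : IsRime c)
    {f g : Fin n → Fin n → K} (d : Fin n → Kˣ)
    (hf : ∀ j k, j < k → c j k k j = f j k)
    (hg : ∀ j k, j < k → c j k k k * d k = g j k * d j) :
    RescalesTo d c (rimeCoeffs f g) := by
  let φ : Alg c →ₐ[K] Alg (rimeCoeffs f g) :=
    liftAlg hl hr (fun i => (d i : K) • x _ i) fun j k h => by
      simp only [smul_mul_smul_comm, smul_smul]
      rw [x_mul_x_rimeCoeffs f g h, hf j k h, smul_add, smul_smul, smul_smul]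
      congr 2
      · ring
      · linear_combination -(d k : K) * hg j k h
  let ψ : Alg (rimeCoeffs f g) →ₐ[K] Alg c :=
    liftRime (fun i => ((d i)⁻¹ : Kˣ).val • x c i) fun j k h => by
      simp only [smul_mul_smul_comm, smul_smul]
      rw [x_mul_x hl hr h, hf j k h, smul_add, smul_smul, smul_smul]
      have hj := (d j).ne_zero
      have hk := (d k).ne_zero
      congr 2
      · ring
      · simp only [Units.val_inv_eq_inv_val]
        field_simp
        linear_combination hg j k h
  have hφ : ∀ i, φ (x c i) = (d i : K) • x _ i := liftAlg_x _ _ _ _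
  have hψ : ∀ i, ψ (x _ i) = ((d i)⁻¹ : Kˣ).val • x c i := liftRime_x _ _
  exact ⟨AlgEquiv.ofAlgHom φ ψ
    (Alg.algHom_ext fun i => by simp [hψ, hφ, smul_smul])
    (Alg.algHom_ext fun i => by simp [hψ, hφ, smul_smul]), hφ⟩

/-! ### Identities in degree three -/

/-- The two ways of ordering `x i * x j * x k`, `i < j < k`. -/
theorem overlap_eq_zero {A : Type*} [Ring A] [Algebra K A] {x y z : A} {α β γ a b c : K}
    (hxy : x * y = α • (y * x) + a • (y * y)) (hxz : x * z = β • (z * x) + b • (z * z))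
    (hyz : y * z = γ • (z * y) + c • (z * z)) :
    (β * c * (α - β)) • (z * (z * x)) + (a * γ * (γ - β)) • (z * (y * y)) +
      (γ * (α * b * γ + a * c * (1 + γ) - b)) • (z * (z * y)) +
      (c * ((1 + γ) * (α * b + a * c) - b * (1 + β))) • (z * (z * z)) = 0 := by
  have hyz' : ∀ w, y * (z * w) = γ • (z * (y * w)) + c • (z * (z * w)) := fun w => by
    rw [← mul_assoc, hyz]; simp [add_mul, mul_assoc]
  have hxz' : ∀ w, x * (z * w) = β • (z * (x * w)) + b • (z * (z * w)) := fun w => by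
    rw [← mul_assoc, hxz]; simp [add_mul, mul_assoc]
  have h1 : x * (y * z) = α • (y * (x * z)) + a • (y * (y * z)) := by
    rw [← mul_assoc, hxy]; simp [add_mul, mul_assoc]
  have h2 : x * (y * z) = γ • (x * (z * y)) + c • (x * (z * z)) := by
    rw [hyz]; simp [mul_add]
  have h := h1.symm.trans h2
  simp only [hxz, hyz, hxy, hxz', hyz', mul_add, mul_smul_comm] at h
  rw [← sub_eq_zero] at h
  rw [← h]
  module

/-- The compatibility of the relation `y * z = f • (z * y) + c • (z * z)` with the skew
derivation sending `y` to `a • (y * y)` and `z` to `b • (z * z)`. -/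
theorem skew_derivation_compat {A : Type*} [Ring A] [Algebra K A] {y z : A} {f a b c : K}
    (hyz : y * z = f • (z * y) + c • (z * z)) (h : (1 + f) * (a * c - (1 - f) * b) = 0) :
    (f * b) • (y * (z * z)) + a • (y * (y * z)) =
      (f * f * a) • (z * (y * y)) + (f * b) • (z * (z * y)) +
        (c * b * (1 + f)) • (z * (z * z)) := by
  have hyz' : ∀ w, y * (z * w) = f • (z * (y * w)) + c • (z * (z * w)) := fun w => by
    rw [← mul_assoc, hyz]; simp [add_mul, mul_assoc]
  simp only [hyz, hyz', mul_add, mul_smul_comm]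
  -- These two multiples of the consistency expression are exactly the difference of the two sides
  -- in ordered form.
  have h1 : (f * ((1 + f) * (a * c - (1 - f) * b))) • (z * (z * y)) +
      (c * ((1 + f) * (a * c - (1 - f) * b))) • (z * (z * z)) = 0 := by simp [h]
  rw [← sub_eq_zero, ← h1]
  module


/-! ### Ore extensions and normal forms -/

section OreExtension

variable {A : Type*} [Ring A] [Algebra K A]

/-- The operator `p t ^ m ↦ σ p t ^ (m + 1) + δ p t ^ m` on polynomials in `t` over `A`. -/
noncomputable def skewShift (σ δ : A →ₗ[K] A) : Module.End K (ℕ →₀ A) :=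
  Finsupp.lsum K fun m => Finsupp.lsingle (m + 1) ∘ₗ σ + Finsupp.lsingle m ∘ₗ δ

theorem skewShift_single (σ δ : A →ₗ[K] A) (m : ℕ) (p : A) :
    skewShift σ δ (Finsupp.single m p) =
      Finsupp.single (m + 1) (σ p) + Finsupp.single m (δ p) := by
  simp [skewShift]

/-- The Ore rule `t * p = σ p * t + δ p`, realised by operators. -/
theorem skewShift_mul_lsmul {σ δ : A →ₗ[K] A} (hσ : ∀ p q, σ (p * q) = σ p * σ q)
    (hδ : ∀ p q, δ (p * q) = σ p * δ q + δ p * q) (p : A) :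
    skewShift σ δ * Algebra.lsmul K K (ℕ →₀ A) p =
      Algebra.lsmul K K (ℕ →₀ A) (σ p) * skewShift σ δ + Algebra.lsmul K K (ℕ →₀ A) (δ p) := by
  ext m q : 2
  simp only [LinearMap.comp_apply, Finsupp.lsingle_apply, Module.End.mul_apply,
    LinearMap.add_apply, Algebra.lsmul_coe, Finsupp.smul_single, smul_eq_mul, skewShift_single,
    smul_add, hσ, hδ, Finsupp.single_add, add_assoc]

theorem skewShift_pow_single {σ δ : A →ₗ[K] A} (hσ : σ 1 = 1) (hδ : δ 1 = 0) (m : ℕ) :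
    (skewShift σ δ ^ m) (Finsupp.single 0 1) = Finsupp.single m 1 := by
  induction m with
  | zero => simp
  | succ m ih => rw [pow_succ', Module.End.mul_apply, ih, skewShift_single, hσ, hδ]; simp

end OreExtension

section Basis

variable (f : K) (g : Fin n → Fin n → K)

/-- The condition on `g` under which the relations
`x j * x k = f • (x k * x j) + g j k • (x k * x k)` are consistent. -/
def IsConsistent : Prop :=
  ∀ i j k : Fin n, i < j → j < k → (1 + f) * (g i j * g j k - (1 - f) * g i k) = 0

/-- The rime algebra with constant coefficient `f`. -/
abbrev UAlg : Type _ := Alg (rimeCoeffs (fun _ _ => f) g)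

/-- The generators of `UAlg f g`. -/
noncomputable abbrev ux (i : Fin n) : UAlg f g := x (rimeCoeffs (fun _ _ => f) g) i

theorem ux_mul_ux {j k : Fin n} (h : j < k) :
    ux f g j * ux f g k = f • (ux f g k * ux f g j) + g j k • (ux f g k * ux f g k) :=
  x_mul_x_rimeCoeffs _ g h

end Basis

section OreTower

variable (f : K) (g : Fin (n + 1) → Fin (n + 1) → K)

/-- The coefficients among the generators other than the first. -/
abbrev tailCoeffs : Fin n → Fin n → K := fun j k => g j.succ k.succ

variable {f g} (hg : IsConsistent f g)

include hg in
theorem isConsistent_tailCoeffs : IsConsistent f (tailCoeffs g) := fun _ _ _ hij hjk =>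
  hg _ _ _ (Fin.succ_lt_succ_iff.2 hij) (Fin.succ_lt_succ_iff.2 hjk)

/-- The endomorphism `σ` and the skew derivation `δ` defining multiplication by the first
generator, assembled into the homomorphism `p ↦ !![σ p, δ p; 0, p]`. -/
noncomputable def skewMatrix :
    UAlg f (tailCoeffs g) →ₐ[K] Matrix (Fin 2) (Fin 2) (UAlg f (tailCoeffs g)) :=
  liftRime
    (fun k => !![f • ux f (tailCoeffs g) k,
      g 0 k.succ • (ux f (tailCoeffs g) k * ux f (tailCoeffs g) k); 0, ux f (tailCoeffs g) k])
    fun j k h => by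
      have hyz := ux_mul_ux f (tailCoeffs g) h
      have hc := skew_derivation_compat hyz
        (hg 0 j.succ k.succ (Fin.succ_pos _) (Fin.succ_lt_succ_iff.2 h))
      ext a b
      fin_cases a <;> fin_cases b
      · simp [Matrix.mul_apply, Fin.sum_univ_two, hyz, smul_smul]
        module
      · simp [Matrix.mul_apply, Fin.sum_univ_two, smul_smul, mul_assoc]
        rw [mul_comm (g 0 k.succ), hc]
        module
      · simp [Matrix.mul_apply, Fin.sum_univ_two]
      · simpa [Matrix.mul_apply, Fin.sum_univ_two] using hyz

theorem skewMatrix_ux (k : Fin n) : skewMatrix hg (ux f (tailCoeffs g) k) =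
    !![f • ux f (tailCoeffs g) k,
      g 0 k.succ • (ux f (tailCoeffs g) k * ux f (tailCoeffs g) k); 0, ux f (tailCoeffs g) k] :=
  liftRime_x _ _ k

/-- Triangularity with the identity in the lower corner turns multiplicativity of the matrix map
into multiplicativity of `σ` and the twisted Leibniz rule for `δ`. -/
theorem skewMatrix_bottom (p : UAlg f (tailCoeffs g)) :
    skewMatrix hg p 1 0 = 0 ∧ skewMatrix hg p 1 1 = p := by
  induction p using Alg.induction with
  | algebraMap r => simp [Matrix.algebraMap_matrix_apply]
  | gen i => rw [skewMatrix_ux]; simp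
  | mul a b ha hb => simp [Matrix.mul_apply, Fin.sum_univ_two, ha, hb]
  | add a b ha hb => simp [ha, hb]

/-- The endomorphism of the Ore extension by the first generator. -/
noncomputable def skewEnd : UAlg f (tailCoeffs g) →ₗ[K] UAlg f (tailCoeffs g) :=
  Matrix.entryLinearMap K _ 0 0 ∘ₗ (skewMatrix hg).toLinearMap

/-- The skew derivation of the Ore extension by the first generator. -/
noncomputable def skewDer : UAlg f (tailCoeffs g) →ₗ[K] UAlg f (tailCoeffs g) :=
  Matrix.entryLinearMap K _ 0 1 ∘ₗ (skewMatrix hg).toLinearMap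

theorem skewEnd_mul (p q : UAlg f (tailCoeffs g)) :
    skewEnd hg (p * q) = skewEnd hg p * skewEnd hg q := by
  simp [skewEnd, Matrix.mul_apply, Fin.sum_univ_two, skewMatrix_bottom]

theorem skewDer_mul (p q : UAlg f (tailCoeffs g)) :
    skewDer hg (p * q) = skewEnd hg p * skewDer hg q + skewDer hg p * q := by
  simp [skewEnd, skewDer, Matrix.mul_apply, Fin.sum_univ_two, skewMatrix_bottom]

theorem skewEnd_algebraMap (r : K) : skewEnd hg (algebraMap K _ r) = algebraMap K _ r := by
  simp [skewEnd, Matrix.algebraMap_matrix_apply]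

theorem skewDer_algebraMap (r : K) : skewDer hg (algebraMap K _ r) = 0 := by
  simp [skewDer, Matrix.algebraMap_matrix_apply]

theorem skewEnd_one : skewEnd hg 1 = 1 := by simpa using skewEnd_algebraMap hg 1

theorem skewDer_one : skewDer hg 1 = 0 := by simpa using skewDer_algebraMap hg 1

theorem skewEnd_ux (k : Fin n) :
    skewEnd hg (ux f (tailCoeffs g) k) = f • ux f (tailCoeffs g) k := by
  simp [skewEnd, skewMatrix_ux]

theorem skewDer_ux (k : Fin n) : skewDer hg (ux f (tailCoeffs g) k) =
    g 0 k.succ • (ux f (tailCoeffs g) k * ux f (tailCoeffs g) k) := by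
  simp [skewDer, skewMatrix_ux]

/-- The representation of the algebra on polynomials in the first generator over the algebra
of the other generators. -/
noncomputable def oreRep : UAlg f g →ₐ[K] Module.End K (ℕ →₀ UAlg f (tailCoeffs g)) :=
  liftRime
    (Fin.cons (skewShift (skewEnd hg) (skewDer hg))
      fun k => Algebra.lsmul K K _ (ux f (tailCoeffs g) k))
    fun j k h => by
      obtain ⟨k, rfl⟩ := Fin.exists_succ_eq.2 (Fin.ne_zero_of_lt h)
      induction j using Fin.cases with
      | zero =>
        simp only [Fin.cons_zero, Fin.cons_succ]
        rw [skewShift_mul_lsmul (skewEnd_mul hg) (skewDer_mul hg), skewEnd_ux, skewDer_ux]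
        simp
      | succ j =>
        simp only [Fin.cons_succ]
        rw [← map_mul, ux_mul_ux f (tailCoeffs g) (Fin.succ_lt_succ_iff.1 h)]
        simp

theorem oreRep_zero : oreRep hg (ux f g 0) = skewShift (skewEnd hg) (skewDer hg) :=
  (liftRime_x _ _ 0).trans (by simp)

theorem oreRep_succ (k : Fin n) :
    oreRep hg (ux f g k.succ) = Algebra.lsmul K K _ (ux f (tailCoeffs g) k) :=
  (liftRime_x _ _ k.succ).trans (by simp)

variable (f g) in
/-- The inclusion of the algebra generated by all variables but the first. -/
noncomputable def tailIncl : UAlg f (tailCoeffs g) →ₐ[K] UAlg f g :=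
  liftRime (fun k => ux f g k.succ) fun _ _ h => ux_mul_ux f g (Fin.succ_lt_succ_iff.2 h)

variable (f g) in
theorem tailIncl_ux (k : Fin n) : tailIncl f g (ux f (tailCoeffs g) k) = ux f g k.succ :=
  liftRime_x _ _ k

theorem oreRep_tailIncl (p : UAlg f (tailCoeffs g)) :
    oreRep hg (tailIncl f g p) = Algebra.lsmul K K _ p := by
  have : (oreRep hg).comp (tailIncl f g) = Algebra.lsmul K K (ℕ →₀ UAlg f (tailCoeffs g)) :=
    Alg.algHom_ext fun i => by
      rw [AlgHom.comp_apply, tailIncl_ux, oreRep_succ]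
  exact DFunLike.congr_fun this p

/-- The Ore rule inside the algebra itself; it moves `x 0` to the right and so gives spanning. -/
theorem ux_zero_mul_tailIncl (p : UAlg f (tailCoeffs g)) :
    ux f g 0 * tailIncl f g p =
      tailIncl f g (skewEnd hg p) * ux f g 0 + tailIncl f g (skewDer hg p) := by
  induction p using Alg.induction with
  | algebraMap r =>
    simp [skewEnd_algebraMap, skewDer_algebraMap, Algebra.commutes]
  | gen i =>
    rw [skewEnd_ux, skewDer_ux, tailIncl_ux, ux_mul_ux f g (Fin.succ_pos i)]
    simp [tailIncl_ux]
  | mul a b ha hb =>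
    rw [map_mul, ← mul_assoc, ha, add_mul, mul_assoc, hb, skewEnd_mul, skewDer_mul]
    simp [mul_add, mul_assoc, add_assoc]
  | add a b ha hb =>
    simp only [map_add, mul_add, ha, hb, add_mul]
    abel

variable (f g) in
/-- The map `p t ^ m ↦ p * x 0 ^ m`. -/
noncomputable def normalForm : (ℕ →₀ UAlg f (tailCoeffs g)) →ₗ[K] UAlg f g :=
  Finsupp.lsum K fun m => LinearMap.mulRight K (ux f g 0 ^ m) ∘ₗ (tailIncl f g).toLinearMap

theorem normalForm_single (m : ℕ) (p : UAlg f (tailCoeffs g)) :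
    normalForm f g (Finsupp.single m p) = tailIncl f g p * ux f g 0 ^ m := by
  simp [normalForm]

/-- Acting on the constant polynomial `1` recovers all coefficients, so `normalForm` is injective.
-/
theorem oreRep_normalForm (v : ℕ →₀ UAlg f (tailCoeffs g)) :
    oreRep hg (normalForm f g v) (Finsupp.single 0 1) = v := by
  induction v using Finsupp.induction_linear with
  | zero => simp
  | add u v hu hv => simp [hu, hv]
  | single m p =>
    rw [normalForm_single, map_mul, map_pow, oreRep_zero, oreRep_tailIncl, Module.End.mul_apply,
      skewShift_pow_single (skewEnd_one hg) (skewDer_one hg)]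
    simp

include hg in
-- The range is a left ideal; as it contains `1`, it is everything.
theorem mul_mem_range_normalForm (a b : UAlg f g) (hb : b ∈ LinearMap.range (normalForm f g)) :
    a * b ∈ LinearMap.range (normalForm f g) := by
  induction a using Alg.induction generalizing b with
  | algebraMap r => rw [← Algebra.smul_def]; exact Submodule.smul_mem _ _ hb
  | gen i =>
    obtain ⟨v, rfl⟩ := hb
    induction v using Finsupp.induction_linear with
    | zero => simp
    | add u v hu hv => rw [map_add, mul_add]; exact add_mem hu hv
    | single m p =>
      rw [normalForm_single, ← mul_assoc]
      induction i using Fin.cases with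
      | zero =>
        rw [ux_zero_mul_tailIncl hg, add_mul, mul_assoc, ← pow_succ', ← normalForm_single,
          ← normalForm_single]
        exact add_mem ⟨_, rfl⟩ ⟨_, rfl⟩
      | succ k =>
        rw [show x _ k.succ = _ from (tailIncl_ux f g k).symm, ← map_mul, ← normalForm_single]
        exact ⟨_, rfl⟩
  | mul a c ha hc => rw [mul_assoc]; exact ha _ (hc _ hb)
  | add a c ha hc => rw [add_mul]; exact add_mem (ha _ hb) (hc _ hb)

include hg in
theorem normalForm_bijective : Function.Bijective (normalForm f g) := by
  refine ⟨fun u v huv => ?_, fun a => ?_⟩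
  · rw [← oreRep_normalForm hg u, huv, oreRep_normalForm hg]
  · have h : (1 : UAlg f g) ∈ LinearMap.range (normalForm f g) :=
      ⟨Finsupp.single 0 1, by simp [normalForm_single]⟩
    simpa using mul_mem_range_normalForm hg a 1 h

end OreTower

/-! ### Induction for the ordered basis -/

/-- Decreasing lists in `Fin (n + 1)`, from the multiplicity of `0` and the remaining part. -/
def consZeros (s : Σ _ : ℕ, {l : List (Fin n) // l.Pairwise (· ≥ ·)}) :
    {l : List (Fin (n + 1)) // l.Pairwise (· ≥ ·)} :=
  ⟨s.2.1.map Fin.succ ++ List.replicate s.1 0, by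
    rw [List.pairwise_append]
    refine ⟨?_, ?_, ?_⟩
    · rw [List.pairwise_map]
      exact s.2.2.imp fun h => Fin.succ_le_succ_iff.2 h
    · simp [List.pairwise_replicate]
    · intro a _ b hb
      rw [List.eq_of_mem_replicate hb]
      exact Fin.zero_le a⟩

theorem consZeros_surjective : Function.Surjective (consZeros (n := n)) := by
  rintro ⟨l, hl⟩
  induction l with
  | nil => exact ⟨⟨0, [], by simp⟩, by simp [consZeros]⟩
  | cons a l ih =>
    rw [List.pairwise_cons] at hl
    induction a using Fin.cases with
    | zero =>
      refine ⟨⟨l.length + 1, [], by simp⟩, ?_⟩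
      have : l = List.replicate l.length 0 :=
        List.eq_replicate_of_mem fun b hb => Fin.le_zero_iff.1 (hl.1 b hb)
      exact Subtype.ext (congrArg (0 :: ·) this.symm)
    | succ a =>
      obtain ⟨⟨m, l', hl'⟩, h⟩ := ih hl.2
      have h' : l'.map Fin.succ ++ List.replicate m 0 = l := congrArg Subtype.val h
      refine ⟨⟨m, a :: l', ?_⟩, ?_⟩
      · refine List.pairwise_cons.2 ⟨fun b hb => ?_, hl'⟩
        exact Fin.succ_le_succ_iff.1 (hl.1 _ (by rw [← h']; simp [hb]))
      · simp [consZeros, h']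

theorem orderedMonomial_consZeros (f : K) (g : Fin (n + 1) → Fin (n + 1) → K)
    (s : Σ _ : ℕ, {l : List (Fin n) // l.Pairwise (· ≥ ·)}) :
    orderedMonomial (rimeCoeffs (fun _ _ => f) g) (consZeros s) =
      tailIncl f g (orderedMonomial (rimeCoeffs (fun _ _ => f) (tailCoeffs g)) s.2) *
        ux f g 0 ^ s.1 := by
  have (i : Fin n) : tailIncl f g (x (rimeCoeffs (fun _ _ => f) (tailCoeffs g)) i) =
    x (rimeCoeffs (fun _ _ => f) g) i.succ := tailIncl_ux f g i
  simp [orderedMonomial, consZeros, map_list_prod, Function.comp_def, this]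

/-- A right inverse of `F` reindexes the basis, so injectivity of `F` need not be shown separately.
-/
theorem hasOrderedBasis_of_surjective {c : Coeffs K n} {ι : Type*} (b : Module.Basis ι K (Alg c))
    {F : ι → {l : List (Fin n) // l.Pairwise (· ≥ ·)}} (hF : Function.Surjective F)
    (h : ∀ i, b i = orderedMonomial c (F i)) : HasOrderedBasis c := by
  obtain ⟨G, hG⟩ := hF.hasRightInverse
  have hb : orderedMonomial c = b ∘ G := funext fun l => by simp [h, hG l]
  refine ⟨hb ▸ b.linearIndependent.comp G hG.injective, ?_⟩
  rw [eq_top_iff, ← b.span_eq]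
  refine Submodule.span_mono ?_
  rintro _ ⟨i, rfl⟩
  exact ⟨F i, (h i).symm⟩

theorem hasOrderedBasis_fin_zero (c : Coeffs K 0) : HasOrderedBasis c := by
  have hl : IsLexicographic c := fun j => j.elim0
  have hr : IsRime c := fun j => j.elim0
  -- Needed only for `1 ≠ 0` in the algebra.
  let e : Alg c →ₐ[K] K := liftAlg hl hr Fin.elim0 fun j => j.elim0
  have hm (l) : orderedMonomial c l = 1 := by
    obtain ⟨l, h⟩ := l
    match l with
    | [] => simp [orderedMonomial]
    | a :: _ => exact a.elim0
  have : Subsingleton {l : List (Fin 0) // l.Pairwise (· ≥ ·)} := by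
    refine ⟨fun l l' => Subtype.ext ?_⟩
    exact Subsingleton.elim _ _
  constructor
  · rw [linearIndependent_subsingleton_index_iff]
    intro l h0
    have := congrArg e ((hm l).symm.trans h0)
    simp at this
  · rw [eq_top_iff]
    rintro a -
    have h1 : (1 : Alg c) ∈ Submodule.span K (Set.range (orderedMonomial c)) :=
      Submodule.subset_span ⟨⟨[], by simp⟩, hm _⟩
    have (a : Alg c) : ∃ r : K, a = algebraMap K _ r := by
      induction a using Alg.induction with
      | algebraMap r => exact ⟨r, rfl⟩
      | gen i => exact i.elim0
      | mul a b ha hb =>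
        obtain ⟨r, rfl⟩ := ha
        obtain ⟨s, rfl⟩ := hb
        exact ⟨r * s, by simp⟩
      | add a b ha hb =>
        obtain ⟨r, rfl⟩ := ha
        obtain ⟨s, rfl⟩ := hb
        exact ⟨r + s, by simp⟩
    obtain ⟨r, rfl⟩ := this a
    rw [Algebra.algebraMap_eq_smul_one]
    exact Submodule.smul_mem _ _ h1

theorem hasOrderedBasis_rimeCoeffs (f : K) :
    ∀ (n : ℕ) (g : Fin n → Fin n → K), IsConsistent f g →
      HasOrderedBasis (rimeCoeffs (fun _ _ => f) g)
  | 0, _, _ => hasOrderedBasis_fin_zero _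
  | n + 1, g, hg => by
    obtain ⟨hli, hsp⟩ :=
      hasOrderedBasis_rimeCoeffs f n (tailCoeffs g) (isConsistent_tailCoeffs hg)
    let b := (Finsupp.basis fun _ : ℕ => Module.Basis.mk hli hsp.ge).map
      (LinearEquiv.ofBijective (normalForm f g) (normalForm_bijective hg))
    refine hasOrderedBasis_of_surjective b consZeros_surjective fun s => ?_
    rw [orderedMonomial_consZeros]
    simp [b, normalForm_single]

/-! ### Consistency conditions -/

/-- Necessary conditions for the ordered monomials of degree three to be independent. -/
theorem coeff_conditions {c : Coeffs K n} (hl : IsLexicographic c) (hr : IsRime c)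
    (hli : LinearIndependent K (orderedMonomial c)) {i j k : Fin n} (hij : i < j) (hjk : j < k) :
    c i k k i * c j k k k * (c i j j i - c i k k i) = 0 ∧
      c i j j j * c j k k j * (c j k k j - c i k k i) = 0 ∧
      c j k k k * ((1 + c j k k j) * (c i j j i * c i k k k + c i j j j * c j k k k) -
        c i k k k * (1 + c i k k i)) = 0 := by
  have hik := hij.trans hjk
  have h := overlap_eq_zero (x_mul_x hl hr hij) (x_mul_x hl hr hik) (x_mul_x hl hr hjk)
  let v : Fin 4 → {l : List (Fin n) // l.Pairwise (· ≥ ·)} :=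
    ![⟨[k, k, i], by simp [hik.le]⟩, ⟨[k, j, j], by simp [hjk.le]⟩,
      ⟨[k, k, j], by simp [hjk.le]⟩, ⟨[k, k, k], by simp⟩]
  have hv : Function.Injective v := by
    intro a b hab
    fin_cases a <;> fin_cases b <;>
      simp [v, hij.ne, hij.ne', hik.ne, hik.ne', hjk.ne, hjk.ne'] at hab ⊢
  have hlv := Fintype.linearIndependent_iff.1 (hli.comp v hv)
  have := hlv ![_, _, _, _] (by
    simpa [Fin.sum_univ_four, v, orderedMonomial, ← add_assoc] using h)
  -- The omitted coefficient, of `[k, k, j]`, adds nothing in the strict case: once the swap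
  -- coefficients agree it is a multiple of the same consistency expression.
  exact ⟨this 0, this 1, this 3⟩

theorem isOrderable_rimeCoeffs {f : K} {g : Fin n → Fin n → K} (hg : IsConsistent f g) :
    IsOrderable (rimeCoeffs (fun _ _ => f) g) :=
  ⟨isLexicographic_rimeCoeffs _ _, hasOrderedBasis_rimeCoeffs f n g hg⟩

theorem isConsistent_neg_one (g : Fin n → Fin n → K) : IsConsistent (-1) g :=
  fun _ _ _ _ _ => by ring

theorem isConsistent_one_sub (f : K) :
    IsConsistent f (fun _ _ : Fin n => 1 - f) := fun _ _ _ _ _ => by ring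

/-! ### Classification of strict algebras -/

section Classification

variable {c : Coeffs K n}

/-- The conditions on the coefficients of a strict rime algebra with ordered basis. -/
theorem strict_conditions (ho : IsOrderable c) (hr : IsRime c) (hs : IsStrict c) {i j k : Fin n}
    (hij : i < j) (hjk : j < k) :
    c i j j i = c i k k i ∧ c j k k j = c i k k i ∧
      (1 + c i k k i) * (c i j j j * c j k k k - (1 - c i k k i) * c i k k k) = 0 := by
  have hik := hij.trans hjk
  obtain ⟨h1, h2, h3⟩ := coeff_conditions ho.1 hr ho.2.1 hij hjk
  have e1 : c i j j i = c i k k i := by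
    simpa [(hs i k hik).1, (hs j k hjk).2, sub_eq_zero] using h1
  have e2 : c j k k j = c i k k i := by
    simpa [(hs i j hij).2, (hs j k hjk).1, sub_eq_zero] using h2
  refine ⟨e1, e2, ?_⟩
  rw [e1, e2] at h3
  have := (mul_eq_zero.1 h3).resolve_left (hs j k hjk).2
  linear_combination this

/-- All coefficients of `x k * x j` agree with that for the extreme pair. -/
theorem coeff_swap_eq {c : Coeffs K (n + 1)} (ho : IsOrderable c) (hr : IsRime c)
    (hs : IsStrict c) {j k : Fin (n + 1)} (h : j < k) :
    c j k k j = c 0 (Fin.last n) (Fin.last n) 0 := by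
  have key {i j k : Fin (n + 1)} (hij : i < j) (hjk : j < k) :=
    strict_conditions ho hr hs hij hjk
  -- The triple `0 < k < last` links `(0, k)` to `(0, last)`; afterwards `0 < j < k` links `(j, k)`
  -- to `(0, k)`.
  have h0 {k : Fin (n + 1)} (hk : 0 < k) : c 0 k k 0 = c 0 (Fin.last n) (Fin.last n) 0 := by
    rcases (Fin.le_last k).eq_or_lt with rfl | hkl
    · rfl
    · exact (key hk hkl).1
  rcases (Fin.zero_le j).eq_or_lt with rfl | hj
  · exact h0 h
  · exact (key hj h).2.1.trans (h0 (hj.trans h))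

theorem rescalesTo_typeI (ho : IsOrderable c) (hr : IsRime c)
    (hf : ∀ j k, j < k → c j k k j = -1) :
    RescalesTo 1 c (typeI fun j k => c j k k k) :=
  rescalesTo_rimeCoeffs ho.1 hr 1 hf fun _ _ _ => by simp

theorem exists_rescalesTo_typeII {c : Coeffs K (n + 1)} (ho : IsOrderable c) (hr : IsRime c)
    (hs : IsStrict c) {f : K} (hf : ∀ j k, j < k → c j k k j = f) (h1 : f ≠ 1) (h2 : f ≠ -1) :
    ∃ d, RescalesTo d c (typeII (n + 1) f) := by
  have h1' : 1 - f ≠ 0 := sub_ne_zero.2 h1.symm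
  have h2' : 1 + f ≠ 0 := fun h => h2 (eq_neg_of_add_eq_zero_right h)
  let m := Fin.last n
  -- The target is `g j k * d k = (1 - f) * d j`. Taking `k = m` and `d m = 1` dictates `d j`; the
  -- other cases are the consistency equation for `j < k < m`.
  let d : Fin (n + 1) → Kˣ := fun j =>
    if h : j < m then Units.mk0 (c j m m m / (1 - f)) (div_ne_zero (hs j m h).2 h1') else 1
  have hd {j} (h : j < m) : (d j : K) = c j m m m / (1 - f) := by simp [d, h]
  refine ⟨d, rescalesTo_rimeCoeffs ho.1 hr d hf fun j k hjk => ?_⟩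
  have hjm : j < m := hjk.trans_le (Fin.le_last k)
  rw [hd hjm, mul_div_cancel₀ _ h1']
  rcases (Fin.le_last k).eq_or_lt with rfl | hkm
  · simp [d, m]
  · have h := (strict_conditions ho hr hs hjk hkm).2.2
    rw [hf j _ hjm] at h
    have h' := (mul_eq_zero.1 h).resolve_left h2'
    rw [hd hkm]
    field_simp
    linear_combination h'

theorem exists_rescalesTo (ho : IsOrderable c) (hr : IsRime c) (hs : IsStrict c)
    (h2 : n = 2 → ∀ j k : Fin n, j < k → c j k k j ≠ 1) :
    ∃ d : Fin n → Kˣ,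
      (∃ g : Fin n → Fin n → K, (∀ j k : Fin n, j < k → g j k ≠ 0) ∧
        RescalesTo d c (typeI g)) ∨
      (∃ f : K, f ≠ 0 ∧ f ≠ 1 ∧ RescalesTo d c (typeII n f)) := by
  -- Fewer than two variables fall vacuously under type (i).
  by_cases hneg : ∀ j k, j < k → c j k k j = -1
  · exact ⟨1, Or.inl ⟨_, fun j k h => (hs j k h).2, rescalesTo_typeI ho hr hneg⟩⟩
  push Not at hneg
  obtain ⟨j, k, hjk, hne⟩ := hneg
  obtain _ | n := n
  · exact j.elim0
  have hf (a b : Fin (n + 1)) (h : a < b) : c a b b a = c j k k j :=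
    (coeff_swap_eq ho hr hs h).trans (coeff_swap_eq ho hr hs hjk).symm
  -- With three variables and `f = 1 ≠ -1`, consistency would make a product of two nonzero `g`'s
  -- vanish. In characteristic two, `f = 1` is already type (i).
  have hf1 : c j k k j ≠ 1 := by
    intro h1
    have hn : 2 ≤ n := by
      by_contra hn
      have : n = 1 := by omega
      exact h2 (by omega) j k hjk h1
    let p : Fin (n + 1) := ⟨1, by omega⟩
    have h0p : 0 < p := by simp [p, Fin.lt_def]
    have hpl : p < Fin.last n := by simp only [p, Fin.lt_def, Fin.val_last]; omega
    have h := (strict_conditions ho hr hs h0p hpl).2.2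
    rw [hf 0 _ (h0p.trans hpl)] at h
    have h' := (mul_eq_zero.1 h).resolve_left fun h => hne (eq_neg_of_add_eq_zero_right h)
    rw [h1] at h'
    simp [(hs 0 p h0p).2, (hs p _ hpl).2] at h'
  obtain ⟨d, hd⟩ := exists_rescalesTo_typeII ho hr hs hf hf1 hne
  exact ⟨d, Or.inr ⟨_, (hs j k hjk).1, hf1, hd⟩⟩

end Classification

end RimeAlgebra

theorem mainTheorem9 {K : Type*} [Field K] (n : ℕ) :
    -- every orderable strict rime algebra is, up to rescaling, of type (i) or of type (ii)
    (∀ c : RimeAlgebra.Coeffs K n,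
      RimeAlgebra.IsOrderable c → RimeAlgebra.IsRime c → RimeAlgebra.IsStrict c →
      (n = 2 → ∀ j k : Fin n, j < k → c j k k j ≠ 1) →
      ∃ d : Fin n → Kˣ,
        (∃ g : Fin n → Fin n → K, (∀ j k : Fin n, j < k → g j k ≠ 0) ∧
          RimeAlgebra.RescalesTo d c (RimeAlgebra.typeI g)) ∨
        (∃ f : K, f ≠ 0 ∧ f ≠ 1 ∧
          RimeAlgebra.RescalesTo d c (RimeAlgebra.typeII n f))) ∧
    -- type (i), with no conditions on the coefficients
    (∀ g : Fin n → Fin n → K,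
      RimeAlgebra.IsOrderable (RimeAlgebra.typeI g) ∧
      RimeAlgebra.IsRime (RimeAlgebra.typeI g) ∧
      RimeAlgebra.HasOrderedBasis (RimeAlgebra.typeI g) ∧
      ((∀ j k : Fin n, j < k → g j k ≠ 0) → RimeAlgebra.IsStrict (RimeAlgebra.typeI g))) ∧
    -- type (ii), with arbitrary parameter
    (∀ f : K,
      RimeAlgebra.IsOrderable (RimeAlgebra.typeII n f) ∧
      RimeAlgebra.IsRime (RimeAlgebra.typeII n f) ∧
      RimeAlgebra.HasOrderedBasis (RimeAlgebra.typeII n f) ∧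
      (f ≠ 0 → f ≠ 1 → RimeAlgebra.IsStrict (RimeAlgebra.typeII n f))) := by
  refine ⟨fun c ho hr hs h2 => RimeAlgebra.exists_rescalesTo ho hr hs h2, fun g => ?_, fun f => ?_⟩
  · have h := RimeAlgebra.isOrderable_rimeCoeffs (RimeAlgebra.isConsistent_neg_one g)
    exact ⟨h, RimeAlgebra.isRime_rimeCoeffs _ _, h.2, fun hg =>
      RimeAlgebra.isStrict_rimeCoeffs _ _ fun j k hjk => ⟨by simp, hg j k hjk⟩⟩
  · have h := RimeAlgebra.isOrderable_rimeCoeffs (RimeAlgebra.isConsistent_one_sub (n := n) f)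
    exact ⟨h, RimeAlgebra.isRime_rimeCoeffs _ _, h.2, fun h0 h1 =>
      RimeAlgebra.isStrict_rimeCoeffs _ _ fun _ _ _ => ⟨h0, sub_ne_zero.2 h1.symm⟩⟩
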